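/- Let $\mathbb{P}^9$ be the projective space of quadrics in $\mathbb{P}^3=\mathbb{P}^3_{\mathbb{C}}$, i.e. of nonzero complex symmetric $4\times 4$ matrices up to a nonzero scalar, where the matrix $A$ corresponds to the quadric with equation $x^{T}Ax=0$. For two lines $L,R\subset\mathbb{P}^3$, their Hadamard product $L\star R\subset\mathbb{P}^3$ is the Zariski closure of the set of all coordinatewise products $(p_0q_0:p_1q_1:p_2q_2:p_3q_3)$ with $p\in L$, $q\in R$ and not all $p_iq_i$ equal to $0$. Say that $L\star R$ is a quadratic surface if its homogeneous ideal is generated by a quadratic form; it is then a point of $\mathbb{P}^9$. Let $H\subset\mathbb{P}^9$ be the Zariski closure of the set of all quadratic surfaces of the form $L\star R$ with $L,R\subset\mathbb{P}^3$ lines. Then $H$ is irreducible of dimension $5$, and $H$ is equal to the Zariski closure in $\mathbb{P}^9$ of the set of quadrics whose symmetric matrix $A$ is nonsingular and has an inverse $A^{-1}$ with zero diagonal. Moreover, the quadrics in this last set are exactly the smooth quadrics that are tangent to all four coordinate planes $\{x_i=0\}$, $i=0,1,2,3$. -/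

import Mathlib

open scoped LinearAlgebra.Projectivization

namespace HadamardQuadrics

noncomputable section

/-- Complex projective space with homogeneous coordinates indexed by `σ`. -/
abbrev PSpace (σ : Type) : Type := ℙ ℂ (σ → ℂ)

/-- The common zeros in projective space of a set `T` of polynomials. It is only used for sets of
homogeneous polynomials, for which it does not depend on the chosen representatives. -/
def projZeros {σ : Type} (T : Set (MvPolynomial σ ℂ)) : Set (PSpace σ) :=
  {p | ∀ f ∈ T, MvPolynomial.eval p.rep f = 0}

/-- A projective algebraic set: the zero set of a family of homogeneous polynomials. -/
def IsProjAlgebraic {σ : Type} (Z : Set (PSpace σ)) : Prop :=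
  ∃ T : Set (MvPolynomial σ ℂ), (∀ f ∈ T, ∃ n : ℕ, f.IsHomogeneous n) ∧ Z = projZeros T

/-- The Zariski topology on projective space. -/
instance zariskiTopology (σ : Type) : TopologicalSpace (PSpace σ) :=
  TopologicalSpace.ofClosed {Z | IsProjAlgebraic Z}
    ⟨{1}, by
      rintro f rfl
      exact ⟨0, MvPolynomial.isHomogeneous_one σ ℂ⟩, by
      ext p
      simp [projZeros]⟩
    (by
      intro A hA
      have hA' : ∀ Z ∈ A, IsProjAlgebraic Z := fun Z hZ => hA hZ
      choose! T hT hZ using hA'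
      refine ⟨⋃ Z ∈ A, T Z, ?_, ?_⟩
      · intro f hf
        simp only [Set.mem_iUnion] at hf
        obtain ⟨Z, hZA, hfZ⟩ := hf
        exact hT Z hZA f hfZ
      · ext p
        simp only [Set.mem_sInter, projZeros, Set.mem_iUnion, Set.mem_ofPred_eq]
        constructor
        · rintro h f ⟨Z, hZA, hfZ⟩
          have hp := h Z hZA
          rw [hZ Z hZA] at hp
          exact hp f hfZ
        · intro h Z hZA
          rw [hZ Z hZA]
          exact fun f hf => h f ⟨Z, hZA, hf⟩)
    (by
      rintro Z ⟨T, hT, rfl⟩ W ⟨S, hS, rfl⟩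
      refine ⟨{h | ∃ f ∈ T, ∃ g ∈ S, h = f * g}, ?_, ?_⟩
      · rintro h ⟨f, hf, g, hg, rfl⟩
        obtain ⟨m, hm⟩ := hT f hf
        obtain ⟨n, hn⟩ := hS g hg
        exact ⟨m + n, hm.mul hn⟩
      · ext p
        simp only [Set.mem_union, projZeros, Set.mem_ofPred_eq]
        constructor
        · rintro (h | h) _ ⟨f, hf, g, hg, rfl⟩
          · rw [map_mul, h f hf, zero_mul]
          · rw [map_mul, h g hg, mul_zero]
        · intro h
          by_contra hcon
          push Not at hcon
          obtain ⟨⟨f, hf, hf0⟩, g, hg, hg0⟩ := hcon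
          have hfg := h _ ⟨f, hf, g, hg, rfl⟩
          rw [map_mul] at hfg
          exact (mul_ne_zero hf0 hg0) hfg)

/-- The affine cone over a subset of projective space. -/
def affineCone {σ : Type} (W : Set (PSpace σ)) : Set (σ → ℂ) :=
  {v | ∃ p ∈ W, v ∈ p.submodule}

/-- The homogeneous ideal of a subset of projective space. -/
def homogeneousIdeal {σ : Type} (W : Set (PSpace σ)) : Ideal (MvPolynomial σ ℂ) :=
  MvPolynomial.vanishingIdeal ℂ (affineCone W)

/-- A line in `ℙ³`: the set of points of a two-dimensional linear subspace of `ℂ⁴`. -/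
def IsLine (L : Set (PSpace (Fin 4))) : Prop :=
  ∃ S : Submodule ℂ (Fin 4 → ℂ), Module.finrank ℂ S = 2 ∧ L = {p | p.submodule ≤ S}

/-- The Hadamard product of two subsets of projective space: the Zariski closure of the set of
coordinatewise products `p ⋆ q` that exist, with `p` in the first set and `q` in the second. -/
def hadamardProduct {σ : Type} (X Y : Set (PSpace σ)) : Set (PSpace σ) :=
  closure {r | ∃ p ∈ X, ∃ q ∈ Y, ∃ h : p.rep * q.rep ≠ 0,
    r = Projectivization.mk ℂ (p.rep * q.rep) h}

/-- The 9-dimensional projective space of quadrics in `ℙ³`. The homogeneous coordinates are the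
ten entries of a symmetric `4 × 4` matrix, indexed by unordered pairs of elements of `Fin 4`. -/
abbrev QuadricSpace : Type := PSpace (Sym2 (Fin 4))

/-- A symmetric matrix of the quadric `Q` (unique up to a nonzero scalar). -/
def quadricMatrix (Q : QuadricSpace) : Matrix (Fin 4) (Fin 4) ℂ :=
  Matrix.of fun i j => Q.rep s(i, j)

/-- An equation `xᵀ A x` of the quadric `Q` (unique up to a nonzero scalar). -/
def quadricForm (Q : QuadricSpace) : MvPolynomial (Fin 4) ℂ :=
  ∑ i, ∑ j, MvPolynomial.C (quadricMatrix Q i j) * MvPolynomial.X i * MvPolynomial.X j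

/-- `W` is a quadratic surface, namely the one with equation `Q`: it is the zero set of the
quadratic form, and that form generates its homogeneous ideal (so that, for instance, a plane is
not a quadratic surface). -/
def IsQuadraticSurface (W : Set (PSpace (Fin 4))) (Q : QuadricSpace) : Prop :=
  W = projZeros {quadricForm Q} ∧ homogeneousIdeal W = Ideal.span {quadricForm Q}

/-- The quadratic surfaces that are Hadamard products of two lines. -/
def hadamardQuadrics : Set QuadricSpace :=
  {Q | ∃ L R : Set (PSpace (Fin 4)), IsLine L ∧ IsLine R ∧
    IsQuadraticSurface (hadamardProduct L R) Q}

/-- The quadrics given by a nonsingular symmetric matrix whose inverse has zero diagonal. -/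
def nullDiagonalInverseQuadrics : Set QuadricSpace :=
  {Q | IsUnit (quadricMatrix Q).det ∧ ∀ i, (quadricMatrix Q)⁻¹ i i = 0}

/-- The partial derivative in the `j`-th variable of the equation of `Q`, evaluated at `p`. -/
def gradientAt (Q : QuadricSpace) (p : PSpace (Fin 4)) (j : Fin 4) : ℂ :=
  MvPolynomial.eval p.rep (MvPolynomial.pderiv j (quadricForm Q))

/-- The quadric is smooth: at each of its points some partial derivative does not vanish. -/
def IsSmoothQuadric (Q : QuadricSpace) : Prop :=
  ∀ p ∈ projZeros {quadricForm Q}, ∃ j, gradientAt Q p j ≠ 0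

/-- The embedded projective tangent space of the quadric `Q` at `p`. -/
def tangentSpaceAt (Q : QuadricSpace) (p : PSpace (Fin 4)) : Set (PSpace (Fin 4)) :=
  {x | ∑ j, gradientAt Q p j * x.rep j = 0}

/-- The coordinate plane `x i = 0`. -/
def coordPlane (i : Fin 4) : Set (PSpace (Fin 4)) :=
  {x | x.rep i = 0}

/-- The quadric is tangent to the plane `H`: at some point of the quadric, the embedded tangent
space is `H`. -/
def IsTangentTo (Q : QuadricSpace) (H : Set (PSpace (Fin 4))) : Prop :=
  ∃ p ∈ projZeros {quadricForm Q}, tangentSpaceAt Q p = H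

/-- The smooth quadrics tangent to all four coordinate planes. -/
def tangentQuadrics : Set QuadricSpace :=
  {Q | IsSmoothQuadric Q ∧ ∀ i, IsTangentTo Q (coordPlane i)}

end

end HadamardQuadrics

namespace HadamardQuadrics

open MvPolynomial Matrix

/-! Let `M` be the matrix with rows `(a i, b i) ⊗ (c i, d i)`. Coordinatewise products of points of
the lines `⟨a, b⟩` and `⟨c, d⟩` are the images under `M` of the points of the Segre quadric, whose
matrix is `J = segreMatrix`. If `M` is singular, the product lies in a plane and is no quadratic
surface. If `M` is invertible, the product is the quadric `A` with `A⁻¹` proportional to `M J Mᵀ`.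
The diagonal entries of `M J Mᵀ` are the values of the Segre form on the rows of `M`, and these
vanish because the rows are decomposable tensors. Conversely, every nonsingular symmetric `A` over ℂ
satisfies `Mᵀ A M = J` for some invertible `M`. A zero diagonal of `A⁻¹ = M J Mᵀ` puts every row of
`M` on the Segre cone, so the rows factor and yield two lines. Hence the two sets of quadrics agree
even before taking closures (`hadamardQuadrics_eq`). Tangency to `x i = 0` means that `A p` is
proportional to `e_i` at a point `p` of the quadric; then `p` is proportional to `A⁻¹ e_i`, where
the form is a nonzero multiple of `A⁻¹ i i` (`isTangentTo_coordPlane_iff`). Inversion transports the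
6-dimensional linear space of symmetric matrices with zero diagonal to these quadrics.
Irreducibility follows by joining two inverses by a line. For the dimension, the adjugate map bounds
the transcendence degree of the cone by 6 (`topologicalKrullDim_closure_le`), and a full flag in the
linear space gives a chain of irreducible closed sets of length 5
(`strictMono_closure_inverseQuadrics_flagSpace`). -/

/-! ### Cones, homogeneous ideals and Zariski closure in projective space. -/

theorem eval_smul_of_isHomogeneous {σ : Type} {f : MvPolynomial σ ℂ} {n : ℕ}
    (hf : f.IsHomogeneous n) (c : ℂ) (v : σ → ℂ) : eval (c • v) f = c ^ n * eval v f := by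
  rw [eval_eq, eval_eq, Finset.mul_sum]
  refine Finset.sum_congr rfl fun d hd => ?_
  have hn : ∑ i ∈ d.support, d i = n := by
    have := hf.degree_eq_sum_deg_support hd
    rw [this]
  simp only [Pi.smul_apply, smul_eq_mul, mul_pow, Finset.prod_mul_distrib,
    Finset.prod_pow_eq_pow_sum, hn]
  ring

theorem exists_rep_eq_smul {σ : Type} {v : σ → ℂ} (hv : v ≠ 0) :
    ∃ c : ℂ, c ≠ 0 ∧ (Projectivization.mk ℂ v hv).rep = c • v := by
  obtain ⟨a, ha⟩ := Projectivization.exists_smul_eq_mk_rep ℂ v hv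
  exact ⟨a, a.ne_zero, ha.symm⟩

theorem eval_rep_mk_eq_zero_iff {σ : Type} {f : MvPolynomial σ ℂ} {n : ℕ}
    (hf : f.IsHomogeneous n) {v : σ → ℂ} (hv : v ≠ 0) :
    eval (Projectivization.mk ℂ v hv).rep f = 0 ↔ eval v f = 0 := by
  obtain ⟨c, hc, h⟩ := exists_rep_eq_smul hv
  rw [h, eval_smul_of_isHomogeneous hf]
  simp [hc]

theorem mem_affineCone {σ : Type} {W : Set (PSpace σ)} {v : σ → ℂ} :
    v ∈ affineCone W ↔ ∃ p ∈ W, ∃ c : ℂ, c • p.rep = v := by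
  simp only [affineCone, Projectivization.submodule_eq, Submodule.mem_span_singleton]
  rfl

theorem rep_mem_affineCone {σ : Type} {W : Set (PSpace σ)} {p : PSpace σ} (hp : p ∈ W) :
    p.rep ∈ affineCone W :=
  mem_affineCone.2 ⟨p, hp, 1, one_smul _ _⟩

theorem smul_mem_affineCone {σ : Type} {W : Set (PSpace σ)} {v : σ → ℂ}
    (hv : v ∈ affineCone W) (c : ℂ) : c • v ∈ affineCone W := by
  obtain ⟨p, hp, a, rfl⟩ := mem_affineCone.1 hv
  exact mem_affineCone.2 ⟨p, hp, c * a, mul_smul _ _ _⟩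

theorem mem_affineCone_of_ne_zero {σ : Type} {W : Set (PSpace σ)} {v : σ → ℂ} (hv : v ≠ 0) :
    v ∈ affineCone W ↔ Projectivization.mk ℂ v hv ∈ W := by
  constructor
  · intro h
    obtain ⟨p, hp, c, hc⟩ := mem_affineCone.1 h
    have : Projectivization.mk ℂ v hv = p := by
      rw [← p.mk_rep, Projectivization.mk_eq_mk_iff']
      exact ⟨c, hc⟩
    rwa [this]
  · intro h
    obtain ⟨c, hc, h'⟩ := exists_rep_eq_smul hv
    refine mem_affineCone.2 ⟨_, h, c⁻¹, ?_⟩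
    rw [h', smul_smul, inv_mul_cancel₀ hc, one_smul]

theorem mem_homogeneousIdeal {σ : Type} {W : Set (PSpace σ)} {f : MvPolynomial σ ℂ} :
    f ∈ homogeneousIdeal W ↔ ∀ v ∈ affineCone W, eval v f = 0 := by
  rw [homogeneousIdeal, mem_vanishingIdeal_iff]
  rfl

theorem isClosed_iff_isProjAlgebraic {σ : Type} {Z : Set (PSpace σ)} :
    IsClosed Z ↔ IsProjAlgebraic Z := by
  rw [← isOpen_compl_iff]
  change Zᶜᶜ ∈ {Z | IsProjAlgebraic Z} ↔ _
  rw [compl_compl]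
  rfl

theorem isClosed_projZeros_singleton {σ : Type} {f : MvPolynomial σ ℂ} {n : ℕ}
    (hf : f.IsHomogeneous n) : IsClosed (projZeros {f}) :=
  isClosed_iff_isProjAlgebraic.2 ⟨{f}, by rintro _ rfl; exact ⟨n, hf⟩, rfl⟩

theorem mem_projZeros_singleton {σ : Type} {f : MvPolynomial σ ℂ} {p : PSpace σ} :
    p ∈ projZeros {f} ↔ eval p.rep f = 0 := by
  simp [projZeros]

theorem mem_closure_iff_forall_isHomogeneous {σ : Type} {W : Set (PSpace σ)} {p : PSpace σ} :
    p ∈ closure W ↔ ∀ (f : MvPolynomial σ ℂ) (n : ℕ), f.IsHomogeneous n →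
      (∀ q ∈ W, eval q.rep f = 0) → eval p.rep f = 0 := by
  constructor
  · intro hp f n hf hW
    have : closure W ⊆ projZeros {f} :=
      closure_minimal (fun q hq => mem_projZeros_singleton.2 (hW q hq))
        (isClosed_projZeros_singleton hf)
    exact mem_projZeros_singleton.1 (this hp)
  · intro h
    obtain ⟨T, hT, hZ⟩ := isClosed_iff_isProjAlgebraic.1 (isClosed_closure (s := W))
    rw [hZ]
    intro f hf
    obtain ⟨n, hn⟩ := hT f hf
    refine h f n hn fun q hq => ?_
    have hq' : q ∈ projZeros T := hZ ▸ subset_closure hq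
    exact hq' f hf

/-- The cone is stable under scaling, so `t ↦ f (t • v)` is a polynomial in `t` that vanishes on all
of ℂ; its coefficients are the values at `v` of the homogeneous components. -/
theorem homogeneousComponent_mem_homogeneousIdeal {σ : Type} {W : Set (PSpace σ)}
    {f : MvPolynomial σ ℂ} (hf : f ∈ homogeneousIdeal W) (n : ℕ) :
    homogeneousComponent n f ∈ homogeneousIdeal W := by
  rw [mem_homogeneousIdeal] at hf ⊢
  intro v hv
  set P : Polynomial ℂ := ∑ i ∈ Finset.range (f.totalDegree + 1),
    Polynomial.monomial i (eval v (homogeneousComponent i f)) with hP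
  have hP0 : P = 0 := by
    refine Polynomial.funext fun t => ?_
    have := hf _ (smul_mem_affineCone hv t)
    rw [← sum_homogeneousComponent f, map_sum] at this
    rw [hP, Polynomial.eval_finsetSum, Polynomial.eval_zero, ← this]
    refine Finset.sum_congr rfl fun i _ => ?_
    rw [Polynomial.eval_monomial,
      eval_smul_of_isHomogeneous (homogeneousComponent_isHomogeneous i f), mul_comm]
  by_cases hn : n < f.totalDegree + 1
  · have := congrArg (Polynomial.coeff · n) hP0
    simpa [hP, Polynomial.finsetSum_coeff, Polynomial.coeff_monomial, Nat.lt_succ_iff.1 hn, hn]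
      using this
  · rw [homogeneousComponent_eq_zero _ _ (by omega), map_zero]

theorem mem_homogeneousIdeal_iff_homogeneousComponent {σ : Type} {W : Set (PSpace σ)}
    {f : MvPolynomial σ ℂ} :
    f ∈ homogeneousIdeal W ↔ ∀ n, homogeneousComponent n f ∈ homogeneousIdeal W := by
  refine ⟨homogeneousComponent_mem_homogeneousIdeal, fun h => ?_⟩
  rw [← sum_homogeneousComponent f]
  exact Ideal.sum_mem _ fun i _ => h i

theorem isHomogeneous_mem_homogeneousIdeal_iff {σ : Type} {W : Set (PSpace σ)}
    {f : MvPolynomial σ ℂ} {n : ℕ} (hf : f.IsHomogeneous n) :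
    f ∈ homogeneousIdeal W ↔ ∀ p ∈ W, eval p.rep f = 0 := by
  rw [mem_homogeneousIdeal]
  refine ⟨fun h p hp => h _ (rep_mem_affineCone hp), fun h v hv => ?_⟩
  obtain ⟨p, hp, c, rfl⟩ := mem_affineCone.1 hv
  rw [eval_smul_of_isHomogeneous hf, h p hp, mul_zero]

theorem homogeneousIdeal_closure {σ : Type} (W : Set (PSpace σ)) :
    homogeneousIdeal (closure W) = homogeneousIdeal W := by
  ext f
  rw [mem_homogeneousIdeal_iff_homogeneousComponent, mem_homogeneousIdeal_iff_homogeneousComponent]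
  refine forall_congr' fun n => ?_
  have hn := homogeneousComponent_isHomogeneous n f
  rw [isHomogeneous_mem_homogeneousIdeal_iff hn, isHomogeneous_mem_homogeneousIdeal_iff hn]
  exact ⟨fun h p hp => h p (subset_closure hp),
    fun h p hp => mem_closure_iff_forall_isHomogeneous.1 hp _ n hn h⟩

theorem homogeneousIdeal_anti {σ : Type} {W V : Set (PSpace σ)} (h : W ⊆ V) :
    homogeneousIdeal V ≤ homogeneousIdeal W :=
  vanishingIdeal_anti_mono fun _ ⟨p, hp, hv⟩ => ⟨p, h hp, hv⟩

theorem subset_of_homogeneousIdeal_le {σ : Type} {W V : Set (PSpace σ)} (hV : IsClosed V)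
    (h : homogeneousIdeal V ≤ homogeneousIdeal W) : W ⊆ V := by
  intro p hp
  rw [← hV.closure_eq, mem_closure_iff_forall_isHomogeneous]
  intro f n hf hq
  exact (isHomogeneous_mem_homogeneousIdeal_iff hf).1
    (h ((isHomogeneous_mem_homogeneousIdeal_iff hf).2 hq)) p hp

-- A homogeneous ideal need only be tested for primality on homogeneous elements, and their zero
-- sets are closed in projective space, where irreducibility applies.
attribute [local instance] MvPolynomial.gradedAlgebra in
theorem isPrime_homogeneousIdeal {σ : Type} {Z : Set (PSpace σ)} (hZ : IsIrreducible Z) :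
    (homogeneousIdeal Z).IsPrime := by
  have hhom : (homogeneousIdeal Z).IsHomogeneous (homogeneousSubmodule σ ℂ) := by
    intro i f hf
    have h := homogeneousComponent_mem_homogeneousIdeal hf i
    rwa [← MvPolynomial.decomposition.decompose'_apply] at h
  refine hhom.isPrime_of_homogeneous_mem_or_mem ?_ ?_
  · intro h
    obtain ⟨p, hp⟩ := hZ.nonempty
    have h1 : (1 : MvPolynomial σ ℂ) ∈ homogeneousIdeal Z := h ▸ Submodule.mem_top
    simpa using mem_homogeneousIdeal.1 h1 _ (rep_mem_affineCone hp)
  · rintro f g ⟨m, hf⟩ ⟨n, hg⟩ hfg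
    rw [mem_homogeneousSubmodule] at hf hg
    have hsub : Z ⊆ projZeros {f} ∪ projZeros {g} := by
      intro p hp
      have := (isHomogeneous_mem_homogeneousIdeal_iff (hf.mul hg)).1 hfg p hp
      rw [map_mul, mul_eq_zero] at this
      exact this.imp mem_projZeros_singleton.2 mem_projZeros_singleton.2
    rcases isPreirreducible_iff_isClosed_union_isClosed.1 hZ.isPreirreducible _ _
      (isClosed_projZeros_singleton hf) (isClosed_projZeros_singleton hg) hsub with h | h
    · exact .inl ((isHomogeneous_mem_homogeneousIdeal_iff hf).2 fun p hp =>
        mem_projZeros_singleton.1 (h hp))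
    · exact .inr ((isHomogeneous_mem_homogeneousIdeal_iff hg).2 fun p hp =>
        mem_projZeros_singleton.1 (h hp))

theorem isIrreducible_of_forall_isHomogeneous {σ : Type} {W : Set (PSpace σ)} (hne : W.Nonempty)
    (h : ∀ (f g : MvPolynomial σ ℂ) (m n : ℕ), f.IsHomogeneous m → g.IsHomogeneous n →
      (∃ p ∈ W, eval p.rep f ≠ 0) → (∃ p ∈ W, eval p.rep g ≠ 0) →
      ∃ p ∈ W, eval p.rep f ≠ 0 ∧ eval p.rep g ≠ 0) : IsIrreducible W := by
  refine ⟨hne, isPreirreducible_iff_isClosed_union_isClosed.2 fun Z₁ Z₂ h₁ h₂ hW => ?_⟩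
  obtain ⟨S, hS, rfl⟩ := isClosed_iff_isProjAlgebraic.1 h₁
  obtain ⟨T, hT, rfl⟩ := isClosed_iff_isProjAlgebraic.1 h₂
  by_contra! hcon
  obtain ⟨⟨p, hp, hpS⟩, q, hq, hqT⟩ := hcon.imp Set.not_subset.1 Set.not_subset.1
  simp only [projZeros, Set.mem_ofPred_eq, not_forall] at hpS hqT
  obtain ⟨f, hfS, hf⟩ := hpS
  obtain ⟨g, hgT, hg⟩ := hqT
  obtain ⟨m, hm⟩ := hS f hfS
  obtain ⟨n, hn⟩ := hT g hgT
  obtain ⟨r, hr, hrf, hrg⟩ := h f g m n hm hn ⟨p, hp, hf⟩ ⟨q, hq, hg⟩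
  rcases hW hr with h | h
  · exact hrf (h f hfS)
  · exact hrg (h g hgT)

/-- Lift a transcendence basis of `B` to `A` and adjoin `a`. If `a` were algebraic over the
subalgebra generated by the lifts, it would divide a nonzero element of it; that element maps to `0`
in `B`, against the independence of the basis. -/
theorem trdeg_add_one_le_of_surjective {A B : Type} [CommRing A] [IsDomain A] [Algebra ℂ A]
    [CommRing B] [IsDomain B] [Algebra ℂ B] (φ : A →ₐ[ℂ] B) (hφ : Function.Surjective φ)
    {a : A} (ha : a ≠ 0) (h0 : φ a = 0) : Algebra.trdeg ℂ B + 1 ≤ Algebra.trdeg ℂ A := by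
  obtain ⟨ι, x, hx⟩ := exists_isTranscendenceBasis' ℂ B
  choose s hs using hφ
  have hxs : φ ∘ (s ∘ x) = x := funext fun i => hs (x i)
  have hy : AlgebraicIndependent ℂ (s ∘ x) := .of_comp φ (by rw [hxs]; exact hx.1)
  have htr : Transcendental (Algebra.adjoin ℂ (Set.range (s ∘ x))) a := by
    intro halg
    obtain ⟨⟨c, hc⟩, hc0, b, hb⟩ := halg.exists_nonzero_dvd (mem_nonZeroDivisors_of_ne_zero ha)
    rw [Algebra.adjoin_range_eq_range_aeval] at hc
    obtain ⟨p, hp⟩ := hc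
    have hcb : c = a * b := hb
    have h1 : aeval x p = 0 := by
      rw [← hxs]
      refine (comp_aeval_apply (s ∘ x) φ p).symm.trans ?_
      rw [show aeval (s ∘ x) p = c from hp, hcb, map_mul, h0, zero_mul]
    have h2 : p = 0 := hx.1 (by rw [h1, map_zero])
    apply hc0
    ext
    rw [h2] at hp
    simpa using hp.symm
  have := ((hy.option_iff_transcendental a).2 htr).cardinalMk_le_trdeg
  rwa [Cardinal.mk_option, hx.cardinalMk_eq_trdeg] at this

/-! ### Quadrics as symmetric matrices; smoothness and tangency. -/

theorem quadricMatrix_isSymm (Q : QuadricSpace) : (quadricMatrix Q).IsSymm := by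
  ext i j
  simp [quadricMatrix, Sym2.eq_swap]

theorem quadricMatrix_ne_zero (Q : QuadricSpace) : quadricMatrix Q ≠ 0 := by
  intro h
  apply Q.rep_nonzero
  funext s
  induction s using Sym2.ind with
  | _ i j => exact congrFun (congrFun h i) j

theorem exists_quadricMatrix_mk_eq_smul {v : Sym2 (Fin 4) → ℂ} (hv : v ≠ 0)
    {A : Matrix (Fin 4) (Fin 4) ℂ} (h : ∀ i j, v s(i, j) = A i j) :
    ∃ c : ℂ, c ≠ 0 ∧ quadricMatrix (Projectivization.mk ℂ v hv) = c • A := by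
  obtain ⟨c, hc, h'⟩ := exists_rep_eq_smul hv
  refine ⟨c, hc, ?_⟩
  ext i j
  simp [quadricMatrix, h', h]

theorem eval_quadricForm (Q : QuadricSpace) (v : Fin 4 → ℂ) :
    eval v (quadricForm Q) = v ⬝ᵥ quadricMatrix Q *ᵥ v := by
  simp only [quadricForm, map_sum, map_mul, eval_C, eval_X, dotProduct, mulVec, Finset.mul_sum]
  exact Finset.sum_congr rfl fun i _ => Finset.sum_congr rfl fun j _ => by ring

theorem isHomogeneous_quadricForm (Q : QuadricSpace) : (quadricForm Q).IsHomogeneous 2 :=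
  IsHomogeneous.sum _ _ _ fun i _ => IsHomogeneous.sum _ _ _ fun j _ => by
    simpa using ((isHomogeneous_C (Fin 4) (quadricMatrix Q i j)).mul (isHomogeneous_X ℂ i)).mul
      (isHomogeneous_X ℂ j)

theorem gradientAt_eq (Q : QuadricSpace) (p : PSpace (Fin 4)) (j : Fin 4) :
    gradientAt Q p j = 2 * (quadricMatrix Q *ᵥ p.rep) j := by
  have hs : ∀ i, quadricMatrix Q i j = quadricMatrix Q j i := fun i =>
    (quadricMatrix_isSymm Q).apply j i
  have : ∀ i k : Fin 4, eval p.rep (pderiv j (C (quadricMatrix Q i k) * X i * X k)) =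
      (if i = j then quadricMatrix Q i k * p.rep k else 0) +
        if k = j then quadricMatrix Q i k * p.rep i else 0 := by
    intro i k
    rw [Derivation.leibniz, Derivation.leibniz, pderiv_C, pderiv_X, pderiv_X]
    simp only [Pi.single_apply, smul_eq_mul, map_add, map_mul, eval_C, eval_X, mul_zero, add_zero]
    split_ifs <;> simp <;> ring
  simp only [gradientAt, quadricForm, map_sum, this, Finset.sum_add_distrib, mulVec, dotProduct]
  rw [Finset.sum_comm]
  simp [hs, two_mul]

theorem dotProduct_mulVec_comm {A : Matrix (Fin 4) (Fin 4) ℂ} (hA : A.IsSymm)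
    (u v : Fin 4 → ℂ) : u ⬝ᵥ A *ᵥ v = v ⬝ᵥ A *ᵥ u := by
  rw [dotProduct_mulVec, ← mulVec_transpose, hA.eq, dotProduct_comm]

theorem isSmoothQuadric_iff (Q : QuadricSpace) :
    IsSmoothQuadric Q ↔ IsUnit (quadricMatrix Q).det := by
  rw [isUnit_iff_ne_zero]
  constructor
  · intro h hdet
    obtain ⟨v, hv, hAv⟩ := exists_mulVec_eq_zero_iff.2 hdet
    obtain ⟨c, -, hc⟩ := exists_rep_eq_smul hv
    obtain ⟨j, hj⟩ := h (Projectivization.mk ℂ v hv) (by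
      rw [mem_projZeros_singleton, eval_quadricForm, hc, mulVec_smul, hAv]
      simp)
    rw [gradientAt_eq, hc, mulVec_smul, hAv] at hj
    simp at hj
  · intro h p _
    by_contra! hcon
    apply p.rep_nonzero
    refine eq_zero_of_mulVec_eq_zero h (funext fun j => ?_)
    simpa [gradientAt_eq] using hcon j

/-- The tangent space at `p` has coefficient vector `2 A p`, so the only candidate for the point of
tangency is `A⁻¹ e_i`. -/
theorem isTangentTo_coordPlane_iff {Q : QuadricSpace} (hQ : IsUnit (quadricMatrix Q).det)
    (i : Fin 4) : IsTangentTo Q (coordPlane i) ↔ (quadricMatrix Q)⁻¹ i i = 0 := by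
  set A := quadricMatrix Q with hA
  have hval : ∀ c : ℂ, (c • A⁻¹ *ᵥ Pi.single i 1) ⬝ᵥ A *ᵥ (c • A⁻¹ *ᵥ Pi.single i 1) =
      c * c * A⁻¹ i i := by
    intro c
    rw [mulVec_smul, mulVec_mulVec, mul_nonsing_inv _ hQ, one_mulVec]
    simp [dotProduct_smul, mul_comm, mul_assoc]
  constructor
  · rintro ⟨p, hp, hT⟩
    rw [mem_projZeros_singleton, eval_quadricForm, ← hA] at hp
    -- The point `e_j` lies in the plane, and the tangent equation at `e_j` isolates the coordinate
    -- `j` of `A p`.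
    have hzero : ∀ j, j ≠ i → (A *ᵥ p.rep) j = 0 := by
      intro j hj
      have hne : (Pi.single j 1 : Fin 4 → ℂ) ≠ 0 := by simp
      obtain ⟨c, hc, h⟩ := exists_rep_eq_smul hne
      have : Projectivization.mk ℂ _ hne ∈ tangentSpaceAt Q p := by
        rw [hT]
        simp [coordPlane, h, hj.symm]
      simpa [tangentSpaceAt, h, gradientAt_eq, Pi.single_apply, hc] using this
    have hAp : A *ᵥ p.rep = (A *ᵥ p.rep) i • Pi.single i 1 := by
      funext j
      by_cases hj : j = i
      · subst hj; simp
      · simp [hzero j hj, hj]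
    set c := (A *ᵥ p.rep) i
    have hpe : p.rep = c • A⁻¹ *ᵥ Pi.single i 1 := by
      rw [← mulVec_smul, ← hAp, mulVec_mulVec, nonsing_inv_mul _ hQ, one_mulVec]
    have hc : c ≠ 0 := by
      intro hc
      exact p.rep_nonzero (by rw [hpe, hc, zero_smul])
    rw [hpe, hval] at hp
    simpa [hc] using hp
  · intro h
    have hne : A⁻¹ *ᵥ Pi.single i 1 ≠ 0 := by
      intro h0
      have := congrArg (A *ᵥ ·) h0
      rw [mulVec_mulVec, mul_nonsing_inv _ hQ, one_mulVec, mulVec_zero] at this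
      simp at this
    obtain ⟨c, hc, hr⟩ := exists_rep_eq_smul hne
    refine ⟨Projectivization.mk ℂ _ hne, ?_, ?_⟩
    · rw [mem_projZeros_singleton, eval_quadricForm, ← hA, hr, hval, h, mul_zero]
    · ext x
      have : A *ᵥ (Projectivization.mk ℂ _ hne).rep = c • Pi.single i 1 := by
        rw [hr, mulVec_smul, mulVec_mulVec, mul_nonsing_inv _ hQ, one_mulVec]
      simp only [tangentSpaceAt, coordPlane, Set.mem_ofPred_eq, gradientAt_eq, ← hA, this]
      simp [Pi.single_apply, hc]

theorem nullDiagonalInverseQuadrics_eq_tangentQuadrics :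
    nullDiagonalInverseQuadrics = tangentQuadrics := by
  ext Q
  simp only [nullDiagonalInverseQuadrics, tangentQuadrics, Set.mem_ofPred_eq, isSmoothQuadric_iff]
  exact and_congr_right fun h => forall_congr' fun i => (isTangentTo_coordPlane_iff h i).symm

/-! ### The Segre quadric and its linear images. -/

/-- The symmetric matrix of the quadratic form `2 (x₀ x₃ - x₁ x₂)` of the Segre quadric. -/
def segreMatrix : Matrix (Fin 4) (Fin 4) ℂ :=
  !![0, 0, 0, 1; 0, 0, -1, 0; 0, -1, 0, 0; 1, 0, 0, 0]

theorem segreMatrix_mul_self : segreMatrix * segreMatrix = 1 := by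
  ext i j
  fin_cases i <;> fin_cases j <;> simp [segreMatrix, mul_apply, Fin.sum_univ_four]

theorem segreMatrix_isSymm : segreMatrix.IsSymm := by
  ext i j
  fin_cases i <;> fin_cases j <;> simp [segreMatrix]

theorem isUnit_det_segreMatrix : IsUnit segreMatrix.det :=
  isUnit_det_of_left_inverse segreMatrix_mul_self

theorem dotProduct_segreMatrix_mulVec (w : Fin 4 → ℂ) :
    w ⬝ᵥ segreMatrix *ᵥ w = 2 * (w 0 * w 3 - w 1 * w 2) := by
  simp [segreMatrix, dotProduct, mulVec, Fin.sum_univ_four]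
  ring

/-- The matrix of the multiplication map from the tensor product of the coordinate spaces of the
lines `⟨a, b⟩` and `⟨c, d⟩` to `ℂ⁴`. -/
def productMatrix (a b c d : Fin 4 → ℂ) : Matrix (Fin 4) (Fin 4) ℂ :=
  Matrix.of fun i => ![a i * c i, a i * d i, b i * c i, b i * d i]

theorem productMatrix_mulVec (a b c d : Fin 4 → ℂ) (s t u v : ℂ) :
    productMatrix a b c d *ᵥ ![s * u, s * v, t * u, t * v] = (s • a + t • b) * (u • c + v • d) := by
  funext i
  simp [productMatrix, mulVec, dotProduct, Fin.sum_univ_four]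
  ring

/-- A 2 × 2 matrix of determinant zero is an outer product. This serves twice: for points of the
quadric, and for the rows of the matrix that brings a quadric to Segre form. -/
theorem exists_eq_products {w : Fin 4 → ℂ} (hw : w 0 * w 3 - w 1 * w 2 = 0) :
    ∃ s t u v : ℂ, w = ![s * u, s * v, t * u, t * v] := by
  by_cases h0 : w 0 = 0
  · by_cases h1 : w 1 = 0
    · refine ⟨0, 1, w 2, w 3, ?_⟩
      funext i
      fin_cases i <;> simp [h0, h1]
    · have h2 : w 2 = 0 := by simpa [h0, h1] using hw
      refine ⟨w 1, w 3, 0, 1, ?_⟩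
      funext i
      fin_cases i <;> simp [h0, h2]
  · refine ⟨1, w 2 / w 0, w 0, w 1, ?_⟩
    funext i
    fin_cases i <;> simp <;> field_simp
    linear_combination hw

/-- Polarization at `e_i`, `e_j` and `e_i + e_j`. -/
theorem eq_zero_of_forall_dotProduct_mulVec_eq_zero {A : Matrix (Fin 4) (Fin 4) ℂ} (hA : A.IsSymm)
    (h : ∀ v, v ⬝ᵥ A *ᵥ v = 0) : A = 0 := by
  ext i j
  have hij := h (Pi.single i 1 + Pi.single j 1)
  have hi := h (Pi.single i 1)
  have hj := h (Pi.single j 1)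
  have hs := hA.apply i j
  simp only [mulVec_add, add_dotProduct, dotProduct_add, mulVec_single_one,
    single_one_dotProduct, col_apply] at hij hi hj
  rw [Matrix.zero_apply]
  linear_combination (hij - hi - hj - hs) / 2

theorem isHomogeneous_linearForm (l : Fin 4 → ℂ) :
    (∑ i, C (l i) * X i : MvPolynomial (Fin 4) ℂ).IsHomogeneous 1 :=
  IsHomogeneous.sum _ _ _ fun i _ => isHomogeneous_C_mul_X (l i) i

theorem eval_linearForm (l v : Fin 4 → ℂ) :
    eval v (∑ i, C (l i) * X i : MvPolynomial (Fin 4) ℂ) = l ⬝ᵥ v := by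
  simp [dotProduct]

theorem quadricMatrix_eq_smul_of_quadricForm {Q Q' : QuadricSpace} {c : ℂ}
    (h : quadricForm Q = C c * quadricForm Q') : quadricMatrix Q = c • quadricMatrix Q' := by
  rw [← sub_eq_zero]
  refine eq_zero_of_forall_dotProduct_mulVec_eq_zero
    ((quadricMatrix_isSymm Q).sub ((quadricMatrix_isSymm Q').smul c)) fun v => ?_
  have := congrArg (eval v) h
  rw [map_mul, eval_C, eval_quadricForm, eval_quadricForm] at this
  rw [sub_mulVec, dotProduct_sub, smul_mulVec, dotProduct_smul, this, smul_eq_mul, sub_self]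

theorem quadricForm_ne_zero (Q : QuadricSpace) : quadricForm Q ≠ 0 := by
  intro h
  apply quadricMatrix_ne_zero Q
  simpa using quadricMatrix_eq_smul_of_quadricForm (Q := Q) (Q' := Q) (c := 0) (by simpa using h)

/-- The linear substitution of variables given by a matrix. -/
noncomputable def linearSubst (M : Matrix (Fin 4) (Fin 4) ℂ) :
    MvPolynomial (Fin 4) ℂ →ₐ[ℂ] MvPolynomial (Fin 4) ℂ :=
  aeval fun i => ∑ j, C (M i j) * X j

theorem eval_linearSubst (M : Matrix (Fin 4) (Fin 4) ℂ) (v : Fin 4 → ℂ)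
    (f : MvPolynomial (Fin 4) ℂ) : eval v (linearSubst M f) = eval (M *ᵥ v) f := by
  induction f using MvPolynomial.induction_on with
  | C a => simp [linearSubst]
  | add p q hp hq => simp [hp, hq]
  | mul_X p i hp =>
    rw [map_mul, map_mul, hp, map_mul, eval_X]
    congr 1
    rw [linearSubst, aeval_X, eval_linearForm (M i) v]
    rfl

/-- The linear change of variables given by an invertible matrix. -/
noncomputable def linearSubstEquiv {M : Matrix (Fin 4) (Fin 4) ℂ} (hM : IsUnit M.det) :
    MvPolynomial (Fin 4) ℂ ≃ₐ[ℂ] MvPolynomial (Fin 4) ℂ :=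
  AlgEquiv.ofAlgHom (linearSubst M) (linearSubst M⁻¹)
    (AlgHom.ext fun f => MvPolynomial.funext fun v => by
      simp [eval_linearSubst, mulVec_mulVec, nonsing_inv_mul _ hM])
    (AlgHom.ext fun f => MvPolynomial.funext fun v => by
      simp [eval_linearSubst, mulVec_mulVec, mul_nonsing_inv _ hM])

/-- The form has degree one in `X 3`, and its leading coefficient `X 0` is coprime to `X 1 * X 2`.
-/
theorem irreducible_segreForm :
    Irreducible (X 0 * X 3 + -(X 1 * X 2) : MvPolynomial (Fin 4) ℂ) := by
  refine irreducible_mul_X_add _ _ 3 (X_ne_zero _) (by simp [vars_X]) ?_ ?_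
  · rw [vars_neg]
    intro h
    have := vars_mul _ _ h
    simp [vars_X] at this
  · rw [(X_prime (R := ℂ) (σ := Fin 4) (i := 0)).irreducible.isRelPrime_iff_not_dvd]
    rintro ⟨g, hg⟩
    -- At this point `X 0` vanishes and `X 1 * X 2` does not.
    have := congrArg (eval ![0, 1, 1, 0]) hg
    simp at this

section Parametrization

variable {a b c d : Fin 4 → ℂ} {Q : QuadricSpace} {k : ℂ}

theorem eval_quadricForm_mulVec {M : Matrix (Fin 4) (Fin 4) ℂ}
    (hQ : Mᵀ * quadricMatrix Q * M = k • segreMatrix) (w : Fin 4 → ℂ) :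
    eval (M *ᵥ w) (quadricForm Q) = 2 * k * (w 0 * w 3 - w 1 * w 2) := by
  have : M *ᵥ w ⬝ᵥ quadricMatrix Q *ᵥ M *ᵥ w = w ⬝ᵥ (Mᵀ * quadricMatrix Q * M) *ᵥ w := by
    rw [← mulVec_mulVec, ← mulVec_mulVec, dotProduct_mulVec w, vecMul_transpose]
  rw [eval_quadricForm, this, hQ, smul_mulVec, dotProduct_smul, dotProduct_segreMatrix_mulVec,
    smul_eq_mul]
  ring

theorem irreducible_quadricForm {M : Matrix (Fin 4) (Fin 4) ℂ} (hM : IsUnit M.det) (hk : k ≠ 0)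
    (hQ : Mᵀ * quadricMatrix Q * M = k • segreMatrix) : Irreducible (quadricForm Q) := by
  rw [← MulEquiv.irreducible_iff (linearSubstEquiv hM)]
  have : linearSubstEquiv hM (quadricForm Q) = C (2 * k) * (X 0 * X 3 + -(X 1 * X 2)) := by
    refine MvPolynomial.funext fun w => ?_
    change eval w (linearSubst M _) = _
    rw [eval_linearSubst, eval_quadricForm_mulVec hQ]
    simp only [map_mul, map_add, map_neg, eval_C, eval_X]
    ring
  rw [this, irreducible_isUnit_mul ((isUnit_iff_ne_zero.2 (by simpa using hk)).map C)]
  exact irreducible_segreForm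

/-- The form is irreducible, so it generates a prime ideal, and the Nullstellensatz applies. -/
theorem homogeneousIdeal_projZeros_quadricForm {M : Matrix (Fin 4) (Fin 4) ℂ} (hM : IsUnit M.det)
    (hk : k ≠ 0) (hQ : Mᵀ * quadricMatrix Q * M = k • segreMatrix) :
    homogeneousIdeal (projZeros {quadricForm Q}) = Ideal.span {quadricForm Q} := by
  have hirr := irreducible_quadricForm hM hk hQ
  have hprime : (Ideal.span {quadricForm Q}).IsPrime :=
    (Ideal.span_singleton_prime hirr.ne_zero).2 hirr.prime
  apply le_antisymm
  · rw [← IsPrime.vanishingIdeal_zeroLocus (K := ℂ) (Ideal.span {quadricForm Q}), homogeneousIdeal]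
    refine vanishingIdeal_anti_mono fun v hv => ?_
    have hv' : eval v (quadricForm Q) = 0 := by
      simpa using hv _ (Ideal.mem_span_singleton_self _)
    have key : ∀ u (hu : u ≠ 0), eval u (quadricForm Q) = 0 →
        Projectivization.mk ℂ u hu ∈ projZeros {quadricForm Q} := fun u hu h =>
      mem_projZeros_singleton.2 ((eval_rep_mk_eq_zero_iff (isHomogeneous_quadricForm Q) hu).2 h)
    -- The zero vector lies in the affine cone only if the projective set is nonempty; the first
    -- column of `M` supplies a point, since the Segre form vanishes at `e_0`.
    by_cases h0 : v = 0
    · have hne : M *ᵥ Pi.single 0 1 ≠ 0 := fun h => by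
        have := eq_zero_of_mulVec_eq_zero hM.ne_zero h
        simp at this
      have hmem := rep_mem_affineCone (key _ hne (by
        rw [eval_quadricForm_mulVec hQ]
        simp))
      simpa [h0] using smul_mem_affineCone hmem 0
    · exact (mem_affineCone_of_ne_zero h0).2 (key v h0 hv')
  · rw [Ideal.span_singleton_le_iff_mem,
      isHomogeneous_mem_homogeneousIdeal_iff (isHomogeneous_quadricForm Q)]
    exact fun p hp => mem_projZeros_singleton.1 hp

theorem rep_mem_of_submodule_le {S : Submodule ℂ (Fin 4 → ℂ)} {p : PSpace (Fin 4)} :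
    p.submodule ≤ S ↔ p.rep ∈ S := by
  rw [Projectivization.submodule_eq, Submodule.span_singleton_le_iff_mem]

/-- For invertible `M` the products already fill the whole quadric: pull a point back by `M` to the
Segre cone and factor it there. The closure therefore adds nothing. -/
theorem isQuadraticSurface_hadamardProduct (hM : IsUnit (productMatrix a b c d).det) (hk : k ≠ 0)
    (hQ : (productMatrix a b c d)ᵀ * quadricMatrix Q * productMatrix a b c d = k • segreMatrix) :
    IsQuadraticSurface (hadamardProduct {p | p.submodule ≤ Submodule.span ℂ {a, b}}
      {p | p.submodule ≤ Submodule.span ℂ {c, d}}) Q := by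
  have hset : {r : PSpace (Fin 4) | ∃ p ∈ {p : PSpace (Fin 4) | p.submodule ≤ Submodule.span ℂ {a, b}},
      ∃ q ∈ {p : PSpace (Fin 4) | p.submodule ≤ Submodule.span ℂ {c, d}}, ∃ h : p.rep * q.rep ≠ 0,
        r = Projectivization.mk ℂ (p.rep * q.rep) h} = projZeros {quadricForm Q} := by
    ext r
    constructor
    · rintro ⟨p, hp, q, hq, h, rfl⟩
      obtain ⟨s, t, hst⟩ := Submodule.mem_span_pair.1 (rep_mem_of_submodule_le.1 hp)
      obtain ⟨u, v, huv⟩ := Submodule.mem_span_pair.1 (rep_mem_of_submodule_le.1 hq)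
      rw [mem_projZeros_singleton, eval_rep_mk_eq_zero_iff (isHomogeneous_quadricForm Q),
        ← hst, ← huv, ← productMatrix_mulVec, eval_quadricForm_mulVec hQ]
      simp only [cons_val]
      ring
    · intro hr
      obtain ⟨w, hw⟩ : ∃ w, productMatrix a b c d *ᵥ w = r.rep :=
        ⟨(productMatrix a b c d)⁻¹ *ᵥ r.rep, by
          rw [mulVec_mulVec, mul_nonsing_inv _ hM, one_mulVec]⟩
      rw [mem_projZeros_singleton, ← hw, eval_quadricForm_mulVec hQ] at hr
      obtain ⟨s, t, u, v, rfl⟩ := exists_eq_products (by simpa [hk] using hr)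
      rw [productMatrix_mulVec] at hw
      have hne := hw ▸ r.rep_nonzero
      have h1 : s • a + t • b ≠ 0 := fun h => hne (by rw [h, zero_mul])
      have h2 : u • c + v • d ≠ 0 := fun h => hne (by rw [h, mul_zero])
      obtain ⟨e, he, hpe⟩ := exists_rep_eq_smul h1
      obtain ⟨f, hf, hqf⟩ := exists_rep_eq_smul h2
      have hprod : (Projectivization.mk ℂ _ h1).rep * (Projectivization.mk ℂ _ h2).rep =
          (e * f) • r.rep := by
        rw [hpe, hqf, ← hw, smul_mul_smul_comm]
      refine ⟨Projectivization.mk ℂ _ h1, ?_, Projectivization.mk ℂ _ h2, ?_, ?_, ?_⟩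
      · exact rep_mem_of_submodule_le.2
          (hpe ▸ Submodule.smul_mem _ _ (Submodule.mem_span_pair.2 ⟨s, t, rfl⟩))
      · exact rep_mem_of_submodule_le.2
          (hqf ▸ Submodule.smul_mem _ _ (Submodule.mem_span_pair.2 ⟨u, v, rfl⟩))
      · rw [hprod]
        exact smul_ne_zero (mul_ne_zero he hf) r.rep_nonzero
      · conv_lhs => rw [← r.mk_rep]
        rw [Projectivization.mk_eq_mk_iff']
        refine ⟨(e * f)⁻¹, ?_⟩
        rw [hprod, smul_smul, inv_mul_cancel₀ (mul_ne_zero he hf), one_smul]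
  have hprod : hadamardProduct {p | p.submodule ≤ Submodule.span ℂ {a, b}}
      {p | p.submodule ≤ Submodule.span ℂ {c, d}} = projZeros {quadricForm Q} := by
    rw [hadamardProduct, hset]
    exact (isClosed_projZeros_singleton (isHomogeneous_quadricForm Q)).closure_eq
  rw [IsQuadraticSurface, hprod]
  exact ⟨rfl, homogeneousIdeal_projZeros_quadricForm hM hk hQ⟩

end Parametrization

/-! ### Hadamard products of lines are the quadrics with null-diagonal inverse. -/

theorem exists_eq_span_pair {S : Submodule ℂ (Fin 4 → ℂ)} (hS : Module.finrank ℂ S = 2) :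
    ∃ a b, S = Submodule.span ℂ {a, b} := by
  let B := Module.finBasisOfFinrankEq ℂ S hS
  refine ⟨B 0, B 1, le_antisymm (fun v hv => ?_) ?_⟩
  · have := congrArg Subtype.val (B.sum_repr ⟨v, hv⟩)
    rw [Fin.sum_univ_two] at this
    exact Submodule.mem_span_pair.2 ⟨_, _, this⟩
  · rw [Submodule.span_le]
    rintro _ (rfl | rfl)
    exacts [(B 0).2, (B 1).2]

theorem finrank_span_pair_eq_two {a b : Fin 4 → ℂ}
    (h : ∀ s t : ℂ, s • a + t • b = 0 → s = 0 ∧ t = 0) :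
    Module.finrank ℂ (Submodule.span ℂ {a, b}) = 2 := by
  have hli : LinearIndependent ℂ ![a, b] := LinearIndependent.pair_iff.2 h
  have := finrank_span_eq_card hli
  rwa [range_cons_cons_empty, Fintype.card_fin] at this

/-- The entry is twice the Segre form at row `i`, which is a decomposable tensor. -/
theorem productMatrix_mul_segreMatrix_mul_transpose_diag (a b c d : Fin 4 → ℂ) (i : Fin 4) :
    (productMatrix a b c d * segreMatrix * (productMatrix a b c d)ᵀ) i i = 0 := by
  simp [productMatrix, segreMatrix, mul_apply, Fin.sum_univ_four]
  ring

/-- A nonzero linear form is not a multiple of a quadratic one. This excludes the products that are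
contained in a plane. -/
theorem not_isQuadraticSurface_of_linearForm {W : Set (PSpace (Fin 4))} {l : Fin 4 → ℂ}
    (hl : l ≠ 0) (h : ∀ p ∈ W, l ⬝ᵥ p.rep = 0) (Q : QuadricSpace) :
    ¬ IsQuadraticSurface (closure W) Q := by
  rintro ⟨-, hQ⟩
  have hmem : (∑ i, C (l i) * X i : MvPolynomial (Fin 4) ℂ) ∈ Ideal.span {quadricForm Q} := by
    rw [← hQ, homogeneousIdeal_closure,
      isHomogeneous_mem_homogeneousIdeal_iff (isHomogeneous_linearForm l)]
    exact fun p hp => (eval_linearForm l _).trans (h p hp)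
  obtain ⟨g, hg⟩ := Ideal.mem_span_singleton.1 hmem
  have hne : (∑ i, C (l i) * X i : MvPolynomial (Fin 4) ℂ) ≠ 0 := by
    intro h0
    apply hl
    funext i
    have := eval_linearForm l (Pi.single i 1)
    rw [h0] at this
    simpa using this.symm
  have hg0 : g ≠ 0 := by
    rintro rfl
    exact hne (by rw [hg, mul_zero])
  have hdeg := congrArg totalDegree hg
  rw [totalDegree_mul_of_isDomain (quadricForm_ne_zero Q) hg0,
    (isHomogeneous_linearForm l).totalDegree hne,
    (isHomogeneous_quadricForm Q).totalDegree (quadricForm_ne_zero Q)] at hdeg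
  omega

theorem exists_quadricMatrix_eq_smul_inv {B : Matrix (Fin 4) (Fin 4) ℂ} (hB : B.IsSymm)
    (hdet : IsUnit B.det) : ∃ (Q : QuadricSpace) (k : ℂ), k ≠ 0 ∧ quadricMatrix Q = k • B⁻¹ := by
  have hBinv : (B⁻¹).IsSymm := by rw [IsSymm, transpose_nonsing_inv, hB.eq]
  let v : Sym2 (Fin 4) → ℂ := Sym2.lift ⟨fun i j => B⁻¹ i j, fun i j => (hBinv.apply i j).symm⟩
  have hv : v ≠ 0 := by
    intro h0
    have hz : B⁻¹ = 0 := by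
      ext i j
      exact congrFun h0 s(i, j)
    have := nonsing_inv_mul _ hdet
    rw [hz, Matrix.zero_mul] at this
    exact zero_ne_one this
  obtain ⟨k, hk, hQ⟩ := exists_quadricMatrix_mk_eq_smul (A := B⁻¹) hv fun i j => rfl
  exact ⟨_, k, hk, hQ⟩

theorem inv_eq_smul_of_eq_smul_inv {A B : Matrix (Fin 4) (Fin 4) ℂ} (hB : IsUnit B.det) {k : ℂ}
    (hk : k ≠ 0) (h : A = k • B⁻¹) : IsUnit A.det ∧ A⁻¹ = k⁻¹ • B := by
  constructor
  · rw [h, det_smul]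
    exact ((isUnit_iff_ne_zero.2 hk).pow _).mul (isUnit_nonsing_inv_det_iff.2 hB)
  · refine inv_eq_left_inv ?_
    rw [h, Matrix.smul_mul, Matrix.mul_smul, smul_smul, mul_nonsing_inv _ hB,
      inv_mul_cancel₀ hk, one_smul]

theorem hadamardQuadrics_subset : hadamardQuadrics ⊆ nullDiagonalInverseQuadrics := by
  rintro Q ⟨_, _, ⟨S, hS, rfl⟩, ⟨T, hT, rfl⟩, hQ⟩
  obtain ⟨a, b, rfl⟩ := exists_eq_span_pair hS
  obtain ⟨c, d, rfl⟩ := exists_eq_span_pair hT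
  set M := productMatrix a b c d with hMdef
  have hM : IsUnit M.det := by
    rw [isUnit_iff_ne_zero]
    intro hdet
    -- A left kernel vector of `M` is the equation of a plane that contains all the products.
    obtain ⟨l, hl, hlM⟩ := exists_vecMul_eq_zero_iff.2 hdet
    refine not_isQuadraticSurface_of_linearForm hl ?_ Q hQ
    rintro _ ⟨p, hp, q, hq, h, rfl⟩
    obtain ⟨s, t, hst⟩ := Submodule.mem_span_pair.1 (rep_mem_of_submodule_le.1 hp)
    obtain ⟨u, v, huv⟩ := Submodule.mem_span_pair.1 (rep_mem_of_submodule_le.1 hq)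
    rw [← eval_linearForm, eval_rep_mk_eq_zero_iff (isHomogeneous_linearForm l), eval_linearForm,
      ← hst, ← huv, ← productMatrix_mulVec, dotProduct_mulVec, ← hMdef, hlM, zero_dotProduct]
  set B := M * segreMatrix * Mᵀ with hB
  have hBdet : IsUnit B.det := by
    rw [hB, det_mul, det_mul, det_transpose]
    exact (hM.mul isUnit_det_segreMatrix).mul hM
  have hBsymm : B.IsSymm := by
    rw [IsSymm, hB, transpose_mul, transpose_mul, transpose_transpose, segreMatrix_isSymm.eq,
      Matrix.mul_assoc]
  have hconj : Mᵀ * B⁻¹ * M = segreMatrix := by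
    have hJ : segreMatrix⁻¹ = segreMatrix := inv_eq_left_inv segreMatrix_mul_self
    have hMt : IsUnit (Mᵀ).det := by rwa [det_transpose]
    rw [hB, Matrix.mul_inv_rev, Matrix.mul_inv_rev, hJ, mul_nonsing_inv_cancel_left _ _ hMt,
      Matrix.mul_assoc,
      nonsing_inv_mul _ hM, Matrix.mul_one]
  -- `Q'` is the expected equation of the same surface. Both forms generate its ideal, so they
  -- differ by a unit, which is a constant.
  obtain ⟨Q', k, hk, hQ'⟩ := exists_quadricMatrix_eq_smul_inv hBsymm hBdet
  have hsurf := isQuadraticSurface_hadamardProduct (a := a) (b := b) (c := c) (d := d)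
    (Q := Q') hM hk (by rw [hQ', Matrix.mul_smul, Matrix.smul_mul, hconj])
  have hspan := hQ.2.symm.trans hsurf.2
  rw [Ideal.span_singleton_eq_span_singleton] at hspan
  obtain ⟨u, hu⟩ := hspan.symm
  obtain ⟨e, he, heu⟩ := MvPolynomial.isUnit_iff_eq_C_of_isReduced.1 u.isUnit
  have hA := quadricMatrix_eq_smul_of_quadricForm (by rw [← hu, heu, mul_comm] :
    quadricForm Q = C e * quadricForm Q')
  rw [hQ', smul_smul] at hA
  obtain ⟨hdet, hinv⟩ := inv_eq_smul_of_eq_smul_inv hBdet (mul_ne_zero he.ne_zero hk) hA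
  refine ⟨hdet, fun i => ?_⟩
  rw [hinv, Matrix.smul_apply, hB, hMdef, productMatrix_mul_segreMatrix_mul_transpose_diag,
    smul_zero]

/-- Over an algebraically closed field of characteristic zero, nondegenerate quadratic forms in the
same number of variables are equivalent. -/
theorem exists_transpose_mul_mul_eq_segreMatrix {A : Matrix (Fin 4) (Fin 4) ℂ} (hA : A.IsSymm)
    (hdet : IsUnit A.det) :
    ∃ M : Matrix (Fin 4) (Fin 4) ℂ, IsUnit M.det ∧ Mᵀ * A * M = segreMatrix := by
  have key : ∀ B : Matrix (Fin 4) (Fin 4) ℂ, B.IsSymm → IsUnit B.det →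
      (QuadraticMap.associated (LinearMap.BilinMap.toQuadraticMap
        (Matrix.toLinearMap₂' ℂ B : LinearMap.BilinMap ℂ (Fin 4 → ℂ) ℂ))).SeparatingLeft := by
    intro B hB hBdet
    rw [QuadraticMap.associated_left_inverse]
    · rw [LinearMap.separatingLeft_toLinearMap₂'_iff_det_ne_zero]
      exact hBdet.ne_zero
    · intro x y
      simp only [Matrix.toLinearMap₂'_apply']
      exact dotProduct_mulVec_comm hB x y
  obtain ⟨e⟩ := QuadraticForm.equivalent_of_isAlgClosed _ _
    (key _ segreMatrix_isSymm isUnit_det_segreMatrix) (key A hA hdet)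
  set M := LinearMap.toMatrix' (e.toLinearEquiv : (Fin 4 → ℂ) →ₗ[ℂ] (Fin 4 → ℂ))
  have hconj : Mᵀ * A * M = segreMatrix := by
    rw [← sub_eq_zero]
    refine eq_zero_of_forall_dotProduct_mulVec_eq_zero (IsSymm.sub ?_ segreMatrix_isSymm)
      fun v => ?_
    · rw [IsSymm, transpose_mul, transpose_mul, transpose_transpose, hA.eq, Matrix.mul_assoc]
    · have h := e.map_app v
      simp only [LinearMap.BilinMap.toQuadraticMap_apply, Matrix.toLinearMap₂'_apply'] at h
      have hMv : M *ᵥ v = e v := LinearMap.toMatrix'_mulVec _ v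
      rw [sub_mulVec, dotProduct_sub, sub_eq_zero, ← h, ← hMv, ← mulVec_mulVec, ← mulVec_mulVec,
        dotProduct_mulVec v, vecMul_transpose]
  refine ⟨M, ?_, hconj⟩
  have := congrArg det hconj
  rw [det_mul] at this
  exact isUnit_of_mul_isUnit_right (this ▸ isUnit_det_segreMatrix)

theorem nullDiagonalInverseQuadrics_subset :
    nullDiagonalInverseQuadrics ⊆ hadamardQuadrics := by
  rintro Q ⟨hdet, hdiag⟩
  obtain ⟨M, hM, hconj⟩ := exists_transpose_mul_mul_eq_segreMatrix (quadricMatrix_isSymm Q) hdet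
  have hMt : IsUnit (Mᵀ).det := by rwa [det_transpose]
  have hinv : (quadricMatrix Q)⁻¹ = M * segreMatrix * Mᵀ := by
    have hA : quadricMatrix Q = (Mᵀ)⁻¹ * segreMatrix * M⁻¹ := by
      rw [← hconj, Matrix.mul_assoc Mᵀ, nonsing_inv_mul_cancel_left _ _ hMt,
        mul_nonsing_inv_cancel_right _ _ hM]
    have hJ : segreMatrix⁻¹ = segreMatrix := inv_eq_left_inv segreMatrix_mul_self
    rw [hA, Matrix.mul_inv_rev, Matrix.mul_inv_rev, hJ, nonsing_inv_nonsing_inv _ hM,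
      nonsing_inv_nonsing_inv _ hMt, Matrix.mul_assoc]
  -- The zero diagonal of `M J Mᵀ` says that each row of `M` lies on the Segre cone; factoring the
  -- rows produces `a`, `b`, `c`, `d`.
  have hrow : ∀ i, M i 0 * M i 3 - M i 1 * M i 2 = 0 := by
    intro i
    have h2 : 2 * (M i 0 * M i 3 - M i 1 * M i 2) = 0 := by
      rw [← hdiag i, hinv, ← dotProduct_segreMatrix_mulVec, Matrix.mul_assoc]
      simp only [mul_apply, dotProduct, mulVec, transpose_apply]
    simpa using h2
  choose a b c d habcd using fun i => exists_eq_products (hrow i)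
  obtain rfl : M = productMatrix a b c d := by
    ext i j
    rw [habcd i]
    rfl
  have hker : ∀ w, productMatrix a b c d *ᵥ w = 0 → w = 0 := fun w hw =>
    eq_zero_of_mulVec_eq_zero hM.ne_zero hw
  refine ⟨_, _, ⟨Submodule.span ℂ {a, b}, finrank_span_pair_eq_two fun s t h => ?_, rfl⟩,
    ⟨Submodule.span ℂ {c, d}, finrank_span_pair_eq_two fun u v h => ?_, rfl⟩,
    isQuadraticSurface_hadamardProduct hM one_ne_zero (by rw [hconj, one_smul])⟩
  -- A relation `s a + t b = 0`, multiplied by `c`, becomes a kernel vector of the invertible matrix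
  -- `M`.
  · have hw := hker ![s * 1, s * 0, t * 1, t * 0] (by rw [productMatrix_mulVec, h, zero_mul])
    exact ⟨by simpa using congrFun hw 0, by simpa using congrFun hw 2⟩
  · have hw := hker ![1 * u, 1 * v, 0 * u, 0 * v] (by rw [productMatrix_mulVec, h, mul_zero])
    exact ⟨by simpa using congrFun hw 0, by simpa using congrFun hw 1⟩

theorem hadamardQuadrics_eq : hadamardQuadrics = nullDiagonalInverseQuadrics :=
  hadamardQuadrics_subset.antisymm nullDiagonalInverseQuadrics_subset

/-! ### Bounds for the Krull dimension of a projective set. -/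

/-- The transcendence degree of the coordinate ring of the cone increases strictly along chains of
irreducible closed sets. It is at most `n + 1`, because the ring modulo the kernel of `φ` embeds in
a polynomial ring in `n + 1` variables. -/
theorem topologicalKrullDim_closure_le {σ : Type} [Finite σ] {W : Set (PSpace σ)} {n : ℕ}
    (φ : MvPolynomial σ ℂ →ₐ[ℂ] MvPolynomial (Fin (n + 1)) ℂ)
    (hφ : RingHom.ker φ ≤ homogeneousIdeal W) : topologicalKrullDim (closure W) ≤ n := by
  have hfin : ∀ I : Ideal (MvPolynomial σ ℂ),
      Algebra.trdeg ℂ (MvPolynomial σ ℂ ⧸ I) < Cardinal.aleph0 := fun I =>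
    trdeg_lt_aleph0_of_finiteType
  have hstrict : ∀ I J : Ideal (MvPolynomial σ ℂ), I.IsPrime → J.IsPrime → I < J →
      Algebra.trdeg ℂ (MvPolynomial σ ℂ ⧸ J) + 1 ≤ Algebra.trdeg ℂ (MvPolynomial σ ℂ ⧸ I) := by
    intro I J hI hJ hIJ
    obtain ⟨f, hfJ, hfI⟩ := SetLike.exists_of_lt hIJ
    refine trdeg_add_one_le_of_surjective (Ideal.Quotient.factorₐ ℂ hIJ.le)
      (Ideal.Quotient.factor_surjective hIJ.le) (a := Ideal.Quotient.mk I f) ?_ ?_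
    · rwa [Ne, Ideal.Quotient.eq_zero_iff_mem]
    · rw [Ideal.Quotient.factorₐ_apply_mk]
      exact Ideal.Quotient.eq_zero_iff_mem.2 hfJ
  let ι : TopologicalSpace.IrreducibleCloseds (closure W) →
      TopologicalSpace.IrreducibleCloseds (PSpace σ) :=
    TopologicalSpace.IrreducibleCloseds.map Subtype.val continuous_subtype_val
  have hι : StrictMono ι :=
    TopologicalSpace.IrreducibleCloseds.map_strictMono_of_isInducing Topology.IsInducing.subtypeVal
  let d : TopologicalSpace.IrreducibleCloseds (closure W) → ℕ := fun Z =>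
    Cardinal.toNat (Algebra.trdeg ℂ (MvPolynomial σ ℂ ⧸ homogeneousIdeal (ι Z : Set (PSpace σ))))
  have hd : ∀ Z, (d Z : Cardinal) =
      Algebra.trdeg ℂ (MvPolynomial σ ℂ ⧸ homogeneousIdeal (ι Z : Set (PSpace σ))) := fun Z =>
    Cardinal.cast_toNat_of_lt_aleph0 (hfin _)
  have hprime : ∀ Z, (homogeneousIdeal (ι Z : Set (PSpace σ))).IsPrime := fun Z =>
    isPrime_homogeneousIdeal (ι Z).isIrreducible
  have hdmono : StrictMono d := by
    intro Z Z' h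
    have hlt : ι Z < ι Z' := hι h
    have := hstrict _ _ (hprime Z') (hprime Z)
      (lt_of_le_of_ne (homogeneousIdeal_anti hlt.le) fun h' =>
        hlt.not_ge (subset_of_homogeneousIdeal_le (ι Z).isClosed h'.ge))
    rw [← hd, ← hd] at this
    exact_mod_cast this
  -- The ideal of the origin is a prime strictly above the ideal of any nonempty projective set.
  -- This lower bound absorbs the extra dimension of the cone.
  have hpos : ∀ Z, 1 ≤ d Z := by
    intro Z
    obtain ⟨p, hp⟩ := (ι Z).isIrreducible.nonempty
    obtain ⟨i, hi⟩ := Function.ne_iff.1 p.rep_nonzero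
    have hlt : homogeneousIdeal (ι Z : Set (PSpace σ)) < vanishingIdeal ℂ {(0 : σ → ℂ)} := by
      refine lt_of_le_of_ne (fun f hf => ?_) fun h => ?_
      · rw [mem_vanishingIdeal_singleton_iff]
        refine mem_homogeneousIdeal.1 hf 0 ?_
        simpa using smul_mem_affineCone (rep_mem_affineCone hp) 0
      · have hX : (X i : MvPolynomial σ ℂ) ∈ vanishingIdeal ℂ {(0 : σ → ℂ)} := by
          rw [mem_vanishingIdeal_singleton_iff]
          simp
        rw [← h] at hX
        exact hi (by simpa using mem_homogeneousIdeal.1 hX _ (rep_mem_affineCone hp))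
    have := hstrict _ _ (hprime Z) (inferInstance : (vanishingIdeal ℂ {(0 : σ → ℂ)}).IsMaximal).isPrime
      hlt
    rw [← hd] at this
    exact_mod_cast le_add_self.trans this
  have hle : ∀ Z, d Z ≤ n + 1 := by
    intro Z
    have hker : RingHom.ker φ ≤ homogeneousIdeal (ι Z : Set (PSpace σ)) := by
      refine hφ.trans ((homogeneousIdeal_closure W).ge.trans (homogeneousIdeal_anti ?_))
      exact closure_minimal (by rintro _ ⟨x, -, rfl⟩; exact x.2) isClosed_closure
    have h1 := trdeg_le_of_surjective (Ideal.Quotient.factorₐ ℂ hker)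
      (Ideal.Quotient.factor_surjective hker)
    have h2 := trdeg_le_of_injective (Ideal.kerLiftAlg φ) (Ideal.kerLiftAlg_injective φ)
    have h3 := h1.trans h2
    rw [MvPolynomial.trdeg_of_isDomain, ← hd] at h3
    rw [Cardinal.mk_fin, Cardinal.lift_natCast] at h3
    exact_mod_cast h3
  refine iSup_le fun p => ?_
  have h1 := (p.map d hdmono).head_add_length_le_nat
  have h2 := hpos p.head
  have h3 := hle p.last
  have h4 : d p.head + p.length ≤ d p.last := h1
  exact_mod_cast (by omega : p.length ≤ n)

theorem le_topologicalKrullDim_of_strictMono {X : Type*} [TopologicalSpace X] {W : Set X} {n : ℕ}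
    (Y : Fin (n + 1) → Set X) (hirr : ∀ k, IsIrreducible (Y k)) (hcl : ∀ k, IsClosed (Y k))
    (hsub : ∀ k, Y k ⊆ W) (hY : StrictMono Y) : n ≤ topologicalKrullDim W := by
  have hpre : ∀ k, IsIrreducible (Subtype.val ⁻¹' Y k : Set W) := by
    intro k
    have := Subtype.irreducibleSpace (hirr k)
    have h := (IrreducibleSpace.isIrreducible_univ (Y k)).image (Set.inclusion (hsub k))
      (continuous_inclusion (hsub k)).continuousOn
    rwa [Set.image_univ, Set.range_inclusion] at h
  let F : Fin (n + 1) → TopologicalSpace.IrreducibleCloseds W := fun k =>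
    ⟨Subtype.val ⁻¹' Y k, hpre k, (hcl k).preimage continuous_subtype_val⟩
  have hF : StrictMono F := by
    intro j k hjk
    refine lt_of_le_not_ge (fun x hx => (hY hjk).le hx) fun h => (hY hjk).not_ge fun x hx => ?_
    exact h (show (⟨x, hsub k hx⟩ : W) ∈ F k from hx)
  exact Order.LTSeries.length_le_krullDim (LTSeries.mk n F hF)

/-! ### Quadrics whose inverse lies in a linear space of matrices. -/

/-- The entries of a matrix at representatives of the unordered pairs of indices. -/
noncomputable def entryVec {R : Type} (A : Matrix (Fin 4) (Fin 4) R) : Sym2 (Fin 4) → R :=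
  fun s => A (Quot.out s).1 (Quot.out s).2

theorem rep_eq_entryVec (Q : QuadricSpace) : Q.rep = entryVec (quadricMatrix Q) := by
  funext s
  change Q.rep s = Q.rep (Quot.mk _ (Quot.out s))
  rw [Quot.out_eq]

theorem entryVec_smul (c : ℂ) (A : Matrix (Fin 4) (Fin 4) ℂ) :
    entryVec (c • A) = c • entryVec A := rfl

theorem adjugate_eq_smul_inv {A : Matrix (Fin 4) (Fin 4) ℂ} (hA : IsUnit A.det) :
    A.adjugate = A.det • A⁻¹ := by
  rw [inv_def, smul_smul, Ring.mul_inverse_cancel _ hA, one_smul]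

theorem adjugate_inv {A : Matrix (Fin 4) (Fin 4) ℂ} (hA : IsUnit A.det) :
    A⁻¹.adjugate = A⁻¹.det • A := by
  rw [adjugate_eq_smul_inv (isUnit_nonsing_inv_det_iff.2 hA), nonsing_inv_nonsing_inv _ hA]

/-- The nonsingular quadrics whose inverse matrix lies in a given linear space. -/
def inverseQuadrics (V : Submodule ℂ (Matrix (Fin 4) (Fin 4) ℂ)) : Set QuadricSpace :=
  {Q | IsUnit (quadricMatrix Q).det ∧ (quadricMatrix Q)⁻¹ ∈ V}

theorem inverseQuadrics_mono {V V' : Submodule ℂ (Matrix (Fin 4) (Fin 4) ℂ)} (h : V ≤ V') :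
    inverseQuadrics V ⊆ inverseQuadrics V' := fun _ hQ => ⟨hQ.1, h hQ.2⟩

theorem exists_mem_inverseQuadrics {V : Submodule ℂ (Matrix (Fin 4) (Fin 4) ℂ)}
    {B : Matrix (Fin 4) (Fin 4) ℂ} (hBV : B ∈ V) (hB : B.IsSymm) (hdet : IsUnit B.det) :
    ∃ Q ∈ inverseQuadrics V, ∃ k : ℂ, k ≠ 0 ∧ quadricMatrix Q = k • B⁻¹ := by
  obtain ⟨Q, k, hk, hQ⟩ := exists_quadricMatrix_eq_smul_inv hB hdet
  obtain ⟨h1, h2⟩ := inv_eq_smul_of_eq_smul_inv hdet hk hQ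
  exact ⟨Q, ⟨h1, h2 ▸ V.smul_mem _ hBV⟩, k, hk, hQ⟩

/-- The adjugate of `A⁻¹` is a nonzero multiple of `A`, so nonvanishing of a form at `Q` can be
tested by a polynomial in the entries of the inverse. -/
theorem eval_entryVec_adjugate_inv_ne_zero {f : MvPolynomial (Sym2 (Fin 4)) ℂ} {n : ℕ}
    (hf : f.IsHomogeneous n) {Q : QuadricSpace} (hQ : IsUnit (quadricMatrix Q).det) :
    eval (entryVec (quadricMatrix Q)⁻¹.adjugate) f ≠ 0 ↔ eval Q.rep f ≠ 0 := by
  rw [adjugate_inv hQ, entryVec_smul, ← rep_eq_entryVec, eval_smul_of_isHomogeneous hf]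
  exact mul_ne_zero_iff_left (pow_ne_zero n (isUnit_nonsing_inv_det_iff.2 hQ).ne_zero)

/-- Given `f` nonzero at one quadric and `g` at another, the line in `V` joining the two inverses
carries three nonzero polynomials in one parameter: `f` and `g` at the adjugate, and the
determinant. Some parameter value avoids all their zeros. -/
theorem isIrreducible_inverseQuadrics {V : Submodule ℂ (Matrix (Fin 4) (Fin 4) ℂ)}
    (hne : (inverseQuadrics V).Nonempty) : IsIrreducible (inverseQuadrics V) := by
  refine isIrreducible_of_forall_isHomogeneous hne ?_
  rintro f g m n hf hg ⟨Q₀, h₀, hf₀⟩ ⟨Q₁, h₁, hg₁⟩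
  set B₀ := (quadricMatrix Q₀)⁻¹ with hB₀
  set B₁ := (quadricMatrix Q₁)⁻¹ with hB₁
  have hs₀ : B₀.IsSymm := by rw [IsSymm, transpose_nonsing_inv, (quadricMatrix_isSymm Q₀).eq]
  have hs₁ : B₁.IsSymm := by rw [IsSymm, transpose_nonsing_inv, (quadricMatrix_isSymm Q₁).eq]
  -- The pencil equals `B₀` at parameter `0` and `B₁` at parameter `1`.
  let N : Matrix (Fin 4) (Fin 4) (Polynomial ℂ) :=
    B₀.map Polynomial.C + (Polynomial.X : Polynomial ℂ) • (B₁ - B₀).map Polynomial.C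
  have hN : ∀ t : ℂ, (Polynomial.evalRingHom t).mapMatrix N = B₀ + t • (B₁ - B₀) := by
    intro t
    ext i j
    simp [N]
  let P : MvPolynomial (Sym2 (Fin 4)) ℂ → Polynomial ℂ := fun F => aeval (entryVec N.adjugate) F
  have hP : ∀ F t, (P F).eval t = eval (entryVec (B₀ + t • (B₁ - B₀)).adjugate) F := by
    intro F t
    have h1 : entryVec (B₀ + t • (B₁ - B₀)).adjugate =
        fun s => Polynomial.evalRingHom t (entryVec N.adjugate s) := by
      rw [← hN, ← RingHom.map_adjugate]
      rfl
    rw [h1]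
    change Polynomial.evalRingHom t (aeval (entryVec N.adjugate) F) = _
    induction F using MvPolynomial.induction_on with
    | C a => simp
    | add p q hp hq => simp only [map_add, hp, hq]
    | mul_X p i hp => simp only [map_mul, hp, aeval_X, eval_X]
  have hdetP : ∀ t, N.det.eval t = (B₀ + t • (B₁ - B₀)).det := by
    intro t
    rw [← hN, ← RingHom.map_det]
    rfl
  have hf0 : P f ≠ 0 := by
    intro h
    have := hP f 0
    rw [h, zero_smul, add_zero, Polynomial.eval_zero] at this
    exact (eval_entryVec_adjugate_inv_ne_zero hf h₀.1).2 hf₀ this.symm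
  have hg0 : P g ≠ 0 := by
    intro h
    have := hP g 1
    rw [h, one_smul, add_sub_cancel, Polynomial.eval_zero] at this
    exact (eval_entryVec_adjugate_inv_ne_zero hg h₁.1).2 hg₁ this.symm
  have hd0 : N.det ≠ 0 := by
    intro h
    have := hdetP 0
    rw [h, zero_smul, add_zero, Polynomial.eval_zero] at this
    exact (isUnit_nonsing_inv_det_iff.2 h₀.1).ne_zero this.symm
  obtain ⟨t, ht⟩ : ∃ t, (P f * P g * N.det).eval t ≠ 0 := by
    by_contra! h
    exact mul_ne_zero (mul_ne_zero hf0 hg0) hd0 (Polynomial.funext fun t => by simpa using h t)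
  rw [Polynomial.eval_mul, Polynomial.eval_mul, hP, hP, hdetP] at ht
  set B := B₀ + t • (B₁ - B₀) with hB
  have hBdet : IsUnit B.det := isUnit_iff_ne_zero.2 (right_ne_zero_of_mul ht)
  obtain ⟨Q, hQ, k, hk, hQB⟩ := exists_mem_inverseQuadrics (B := B)
    (V.add_mem h₀.2 (V.smul_mem t (V.sub_mem h₁.2 h₀.2))) (hs₀.add ((hs₁.sub hs₀).smul t)) hBdet
  have key : ∀ (F : MvPolynomial (Sym2 (Fin 4)) ℂ) (l : ℕ), F.IsHomogeneous l →
      eval (entryVec B.adjugate) F ≠ 0 → eval Q.rep F ≠ 0 := by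
    intro F l hF h h0
    apply h
    have : B.adjugate = (B.det * k⁻¹) • quadricMatrix Q := by
      rw [hQB, smul_smul, mul_assoc, inv_mul_cancel₀ hk, mul_one, adjugate_eq_smul_inv hBdet]
    rw [this, entryVec_smul, ← rep_eq_entryVec, eval_smul_of_isHomogeneous hF, h0, mul_zero]
  exact ⟨Q, hQ, key f m hf (left_ne_zero_of_mul (left_ne_zero_of_mul ht)),
    key g n hg (right_ne_zero_of_mul (left_ne_zero_of_mul ht))⟩

/-- The generic symmetric matrix. -/
noncomputable def genericSymm : Matrix (Fin 4) (Fin 4) (MvPolynomial (Sym2 (Fin 4)) ℂ) :=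
  Matrix.of fun i j => X s(i, j)

theorem eval_adjugate_genericSymm (c : ℂ) (Q : QuadricSpace) (i j : Fin 4) :
    eval (c • Q.rep) (genericSymm.adjugate i j) = (c • quadricMatrix Q).adjugate i j := by
  have : (eval (c • Q.rep)).mapMatrix genericSymm = c • quadricMatrix Q := by
    ext i j
    simp [genericSymm, quadricMatrix]
  rw [← this, ← RingHom.map_adjugate]
  rfl

/-- Separate `A⁻¹` from `V` by a linear functional `l`. Then `l (adj A)` is polynomial in the
entries of `A` and equals `det A * l A⁻¹` on nonsingular matrices, so it vanishes on the closure but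
not at `Q`. -/
theorem notMem_closure_inverseQuadrics {V : Submodule ℂ (Matrix (Fin 4) (Fin 4) ℂ)}
    {Q : QuadricSpace} (hQ : IsUnit (quadricMatrix Q).det) (hV : (quadricMatrix Q)⁻¹ ∉ V) :
    Q ∉ closure (inverseQuadrics V) := by
  intro hmem
  obtain ⟨l, hl, hlV⟩ := Submodule.exists_le_ker_of_notMem hV
  let g : MvPolynomial (Sym2 (Fin 4)) ℂ :=
    ∑ i, ∑ j, C (l (Matrix.single i j 1)) * genericSymm.adjugate i j
  have hl_eq : ∀ B, l B = ∑ i, ∑ j, l (Matrix.single i j 1) * B i j := by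
    intro B
    conv_lhs => rw [matrix_eq_sum_single B]
    simp only [map_sum]
    refine Finset.sum_congr rfl fun i _ => Finset.sum_congr rfl fun j _ => ?_
    rw [mul_comm, ← smul_eq_mul, ← map_smul, smul_single, smul_eq_mul, mul_one]
  have hg : ∀ (c : ℂ) (Q : QuadricSpace), eval (c • Q.rep) g = l (c • quadricMatrix Q).adjugate := by
    intro c Q
    rw [hl_eq]
    simp only [g, map_sum, map_mul, eval_C, eval_adjugate_genericSymm]
  have hmemI : g ∈ homogeneousIdeal (closure (inverseQuadrics V)) := by
    rw [homogeneousIdeal_closure, mem_homogeneousIdeal]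
    intro v hv
    obtain ⟨p, hp, c, rfl⟩ := mem_affineCone.1 hv
    rw [hg, adjugate_smul, adjugate_eq_smul_inv hp.1, map_smul, map_smul,
      LinearMap.mem_ker.1 (hlV hp.2), smul_zero, smul_zero]
  have h0 := mem_homogeneousIdeal.1 hmemI _ (rep_mem_affineCone hmem)
  rw [← one_smul ℂ Q.rep, hg, one_smul, adjugate_eq_smul_inv hQ, map_smul, smul_eq_mul] at h0
  exact mul_ne_zero hQ.ne_zero hl h0

/-! ### The space of zero-diagonal matrices and the dimension 5. -/

/-- The symmetric matrix with zero diagonal and given entries above the diagonal. -/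
def zeroDiagMatrix {R : Type} [Zero R] (z : Fin 6 → R) : Matrix (Fin 4) (Fin 4) R :=
  !![0, z 0, z 1, z 2; z 0, 0, z 3, z 4; z 1, z 3, 0, z 5; z 2, z 4, z 5, 0]

theorem zeroDiagMatrix_isSymm (z : Fin 6 → ℂ) : (zeroDiagMatrix z).IsSymm := by
  ext i j
  fin_cases i <;> fin_cases j <;> rfl

theorem zeroDiagMatrix_diag (z : Fin 6 → ℂ) (i : Fin 4) : zeroDiagMatrix z i i = 0 := by
  fin_cases i <;> rfl

theorem exists_zeroDiagMatrix_eq {B : Matrix (Fin 4) (Fin 4) ℂ} (hB : B.IsSymm)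
    (h : ∀ i, B i i = 0) : ∃ z, zeroDiagMatrix z = B := by
  refine ⟨![B 0 1, B 0 2, B 0 3, B 1 2, B 1 3, B 2 3], ?_⟩
  ext i j
  fin_cases i <;> fin_cases j <;> first | exact (h _).symm | rfl | exact hB.apply _ _

theorem zeroDiagMatrix_det (z : Fin 6 → ℂ) : (zeroDiagMatrix z).det =
    (z 0 * z 5) ^ 2 + (z 1 * z 4) ^ 2 + (z 2 * z 3) ^ 2 - 2 * (z 0 * z 5) * (z 1 * z 4) -
      2 * (z 0 * z 5) * (z 2 * z 3) - 2 * (z 1 * z 4) * (z 2 * z 3) := by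
  simp [zeroDiagMatrix, det_succ_row_zero, Fin.sum_univ_succ, Fin.succAbove]
  ring

/-- The linear space of matrices with zero diagonal. -/
def zeroDiag : Submodule ℂ (Matrix (Fin 4) (Fin 4) ℂ) where
  carrier := {B | ∀ i, B i i = 0}
  add_mem' hA hB i := by simp [hA i, hB i]
  zero_mem' _ := rfl
  smul_mem' c _ hA i := by simp [hA i]

/-- The polynomial map sending the entries of a symmetric matrix with zero diagonal to those of its
adjugate. -/
noncomputable def zeroDiagAdjugate :
    MvPolynomial (Sym2 (Fin 4)) ℂ →ₐ[ℂ] MvPolynomial (Fin 6) ℂ :=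
  aeval (entryVec (zeroDiagMatrix X).adjugate)

theorem eval_zeroDiagAdjugate (z : Fin 6 → ℂ) (f : MvPolynomial (Sym2 (Fin 4)) ℂ) :
    eval z (zeroDiagAdjugate f) = eval (entryVec (zeroDiagMatrix z).adjugate) f := by
  have h : entryVec (zeroDiagMatrix z).adjugate =
      fun s => eval z (entryVec (zeroDiagMatrix X).adjugate s) := by
    have : (eval z).mapMatrix (zeroDiagMatrix X) = zeroDiagMatrix z := by
      ext i j
      fin_cases i <;> fin_cases j <;> simp [zeroDiagMatrix]
    rw [← this, ← RingHom.map_adjugate]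
    rfl
  rw [h]
  induction f using MvPolynomial.induction_on with
  | C a => simp [zeroDiagAdjugate]
  | add p q hp hq => simp only [map_add, hp, hq]
  | mul_X p i hp =>
    rw [map_mul, map_mul, hp, map_mul, eval_X, zeroDiagAdjugate, aeval_X]

/-- Every vector of the affine cone over the family is itself the adjugate of a symmetric
zero-diagonal matrix, with no scalar left over. -/
theorem ker_zeroDiagAdjugate_le :
    RingHom.ker zeroDiagAdjugate ≤ homogeneousIdeal nullDiagonalInverseQuadrics := by
  intro f hf
  rw [RingHom.mem_ker] at hf
  rw [mem_homogeneousIdeal]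
  intro v hv
  obtain ⟨Q, ⟨hdet, hdiag⟩, c, rfl⟩ := mem_affineCone.1 hv
  have hBdet := isUnit_nonsing_inv_det_iff.2 hdet
  -- The adjugate of a 4 × 4 matrix is homogeneous of degree 3, so a cube root adjusts the scalar.
  obtain ⟨r, hr⟩ := IsAlgClosed.exists_pow_nat_eq (c / (quadricMatrix Q)⁻¹.det) (n := 3) (by simp)
  have hsymm : (r • (quadricMatrix Q)⁻¹).IsSymm := by
    rw [IsSymm, transpose_smul, transpose_nonsing_inv, (quadricMatrix_isSymm Q).eq]
  obtain ⟨z, hz⟩ := exists_zeroDiagMatrix_eq hsymm fun i => by simp [hdiag i]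
  have h := eval_zeroDiagAdjugate z f
  rw [hf, map_zero, hz, adjugate_smul, adjugate_inv hdet, smul_smul, Fintype.card_fin, hr,
    div_mul_cancel₀ _ hBdet.ne_zero, entryVec_smul, ← rep_eq_entryVec] at h
  exact h.symm

/-- A basis of the symmetric matrices with zero diagonal that consists of nonsingular matrices. -/
noncomputable def flagMatrix (k : Fin 6) : Matrix (Fin 4) (Fin 4) ℂ :=
  zeroDiagMatrix (![![1, 0, 0, 0, 0, 1], ![2, 0, 0, 0, 0, 1], ![1, 1, 0, 0, 0, 1],
    ![1, 0, 1, 0, 0, 1], ![1, 0, 0, 1, 0, 1], ![1, 0, 0, 0, 1, 1]] k)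

/-- In all six vectors `z 1 * z 4 = z 2 * z 3 = 0`, so the determinant is `(z 0 * z 5) ^ 2 ≠ 0`.
Nonsingularity makes each basis matrix the inverse of a quadric. -/
theorem isUnit_det_flagMatrix (k : Fin 6) : IsUnit (flagMatrix k).det := by
  rw [isUnit_iff_ne_zero, flagMatrix, zeroDiagMatrix_det]
  fin_cases k <;> simp

theorem linearIndependent_flagMatrix : LinearIndependent ℂ flagMatrix := by
  rw [Fintype.linearIndependent_iff]
  intro g hg
  have h : ∀ i j, ∑ k, g k * flagMatrix k i j = 0 := by
    intro i j
    have := congrFun (congrFun hg i) j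
    simpa [Matrix.sum_apply] using this
  have h01 := h 0 1
  have h02 := h 0 2
  have h03 := h 0 3
  have h12 := h 1 2
  have h13 := h 1 3
  have h23 := h 2 3
  simp [Fin.sum_univ_six, flagMatrix, zeroDiagMatrix] at h01 h02 h03 h12 h13 h23
  -- Four entries isolate `g 2`, …, `g 5`; the other two leave `g 0 + 2 g 1 = 0` and `g 0 + g 1 =
  -- 0`.
  simp only [h02, h03, h12, h13, add_zero] at h01 h23
  have h1 : g 1 = 0 := by linear_combination h01 - h23
  have h0 : g 0 = 0 := by linear_combination h23 - h1
  intro i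
  fin_cases i <;> assumption

/-- The flag of linear spaces of matrices spanned by initial segments of `flagMatrix`. -/
noncomputable def flagSpace (k : Fin 6) : Submodule ℂ (Matrix (Fin 4) (Fin 4) ℂ) :=
  Submodule.span ℂ (flagMatrix '' Set.Iic k)

theorem flagSpace_le_zeroDiag (k : Fin 6) : flagSpace k ≤ zeroDiag :=
  Submodule.span_le.2 (by rintro _ ⟨j, -, rfl⟩; exact zeroDiagMatrix_diag _)

theorem exists_mem_inverseQuadrics_flagSpace (k : Fin 6) :
    ∃ Q ∈ inverseQuadrics (flagSpace k), ∃ c : ℂ, c ≠ 0 ∧ quadricMatrix Q = c • (flagMatrix k)⁻¹ :=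
  exists_mem_inverseQuadrics (Submodule.subset_span ⟨k, Set.self_mem_Iic, rfl⟩) (zeroDiagMatrix_isSymm _)
    (isUnit_det_flagMatrix k)

/-- The quadric with inverse proportional to `flagMatrix k` is new at stage `k`: by linear
independence its inverse lies outside every earlier `flagSpace`, hence the quadric lies outside the
earlier closures. -/
theorem strictMono_closure_inverseQuadrics_flagSpace :
    StrictMono fun k => closure (inverseQuadrics (flagSpace k)) := by
  intro j k hjk
  refine lt_of_le_not_ge (closure_mono (inverseQuadrics_mono
    (Submodule.span_mono (Set.image_mono (Set.Iic_subset_Iic.2 hjk.le))))) fun h => ?_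
  obtain ⟨Q, hQ, c, hc, hQc⟩ := exists_mem_inverseQuadrics_flagSpace k
  refine notMem_closure_inverseQuadrics hQ.1 (fun hmem => ?_) (h (subset_closure hQ))
  rw [(inv_eq_smul_of_eq_smul_inv (isUnit_det_flagMatrix k) hc hQc).2,
    Submodule.smul_mem_iff _ (inv_ne_zero hc)] at hmem
  exact linearIndependent_flagMatrix.notMem_span_image (by simpa using hjk) hmem

theorem isIrreducible_nullDiagonalInverseQuadrics : IsIrreducible nullDiagonalInverseQuadrics := by
  obtain ⟨Q, hQ, -⟩ := exists_mem_inverseQuadrics_flagSpace 0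
  exact isIrreducible_inverseQuadrics ⟨Q, inverseQuadrics_mono (flagSpace_le_zeroDiag 0) hQ⟩

theorem topologicalKrullDim_closure_nullDiagonalInverseQuadrics :
    topologicalKrullDim (closure nullDiagonalInverseQuadrics) = 5 := by
  apply le_antisymm
  · exact_mod_cast topologicalKrullDim_closure_le (n := 5) zeroDiagAdjugate ker_zeroDiagAdjugate_le
  · refine le_topologicalKrullDim_of_strictMono (n := 5)
      (fun k => closure (inverseQuadrics (flagSpace k))) (fun k => ?_) (fun k => isClosed_closure)
      (fun k => closure_mono (inverseQuadrics_mono (flagSpace_le_zeroDiag k)))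
      strictMono_closure_inverseQuadrics_flagSpace
    obtain ⟨Q, hQ, -⟩ := exists_mem_inverseQuadrics_flagSpace k
    exact (isIrreducible_inverseQuadrics ⟨Q, hQ⟩).closure

end HadamardQuadrics

theorem theorem1 :
    IsIrreducible (closure HadamardQuadrics.hadamardQuadrics) ∧
    topologicalKrullDim (closure HadamardQuadrics.hadamardQuadrics) = 5 ∧
    closure HadamardQuadrics.hadamardQuadrics =
      closure HadamardQuadrics.nullDiagonalInverseQuadrics ∧
    HadamardQuadrics.nullDiagonalInverseQuadrics = HadamardQuadrics.tangentQuadrics := by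
  rw [HadamardQuadrics.hadamardQuadrics_eq]
  exact ⟨HadamardQuadrics.isIrreducible_nullDiagonalInverseQuadrics.closure,
    HadamardQuadrics.topologicalKrullDim_closure_nullDiagonalInverseQuadrics, rfl,
    HadamardQuadrics.nullDiagonalInverseQuadrics_eq_tangentQuadrics⟩
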